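/- For every natural number $n$, there is a linear time reduction of the conjugacy search problem on the braid group $B_n$ to a search problem on the positive braid monoid $B_n^+$. Here $B_n$ is the group, and $B_n^+$ the monoid, presented by generators $\sigma_1,\dots,\sigma_{n-1}$ and the braid relations $\sigma_i\sigma_{i+1}\sigma_i=\sigma_{i+1}\sigma_i\sigma_{i+1}$ and $\sigma_i\sigma_j=\sigma_j\sigma_i$ for $|i-j|\ge 2$. A standard word is a word in the letters $\sigma_i^{\pm1}$; it is positive if it contains no letter $\sigma_i^{-1}$. The symbol $\equiv$ denotes equality of the represented elements, in $B_n$ for standard words and in $B_n^+$ for positive words. The two problems are: (S) the conjugacy search problem on $B_n$: given standard words $U,V$, find a standard word $X$ with $U\equiv X\cdot V\cdot X^{-1}$; (T) given positive standard words $A,B,C,D$, find a positive standard word $M$ with $A\cdot M\cdot B\equiv C\cdot M\cdot D$. That (S) reduces to (T) in linear time means that there are maps $f$ and $g$, each computable by a multi-stack (equivalently, multitape) Turing machine in a number of steps at most linear in the length of its input, with constants depending only on $n$, such that: 1. $f$ takes an instance $(U,V)$ of (S) to an instance $f(U,V)=(A,B,C,D)$ of (T), and if $(U,V)$ has a solution,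 then so has $f(U,V)$; 2. for every $(U,V)$ and every solution $M$ of $f(U,V)$, the standard word $X=g(U,V,M)$ is a solution of $(U,V)$. -/

import Mathlib

/-- A function `f` between types whose elements are presented to machines as strings (through
`ea`, `eb`) is *linear time computable* if some Turing machine with finitely many stacks computes
it in at most `c * k + c` steps on every input string of length `k`, for a constant `c`. -/
def LinearTimeComputable {α β αΓ βΓ : Type} (ea : α → List αΓ) (eb : β → List βΓ)
    (f : α → β) : Prop :=
  ∃ (h : Turing.TM2ComputableInTime ea eb f) (c : ℕ), ∀ k : ℕ, h.time k ≤ c * k + c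

/-- A search problem: given an instance `x`, find a solution `y`, i.e. some `y` with
`IsSolution x y`. Instances and solutions are presented as strings over finite alphabets. -/
structure SearchProblem where
  /-- the instances -/
  Inst : Type
  /-- the candidate solutions -/
  Sol : Type
  /-- `y` solves the instance `x` -/
  IsSolution : Inst → Sol → Prop
  /-- the alphabet in which instances are written -/
  InstAlphabet : Type
  /-- the alphabet in which solutions are written -/
  SolAlphabet : Type
  [instFintype : Fintype InstAlphabet]
  [solFintype : Fintype SolAlphabet]
  /-- how instances are written -/
  encodeInst : Computability.Encoding Inst InstAlphabet
  /-- how solutions are written -/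
  encodeSol : Computability.Encoding Sol SolAlphabet

/-- `P` is *reducible in linear time* to `Q` (as search problems): a linear time computable `f`
turns every instance `x` of `P` into an instance `f x` of `Q`, and a linear time computable `g`
turns `x` and any solution of `f x` into a solution of `x`; moreover if `x` has a solution, then
so has `f x`. -/
def SearchProblem.LinearTimeReducible (P Q : SearchProblem) : Prop :=
  ∃ (f : P.Inst → Q.Inst) (g : P.Inst × Q.Sol → P.Sol),
    LinearTimeComputable P.encodeInst.encode Q.encodeInst.encode f ∧
    LinearTimeComputable (Computability.encodingProd P.encodeInst Q.encodeSol).encode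
      P.encodeSol.encode g ∧
    (∀ x, (∃ y, P.IsSolution x y) → ∃ z, Q.IsSolution (f x) z) ∧
    (∀ x z, Q.IsSolution (f x) z → P.IsSolution x (g (x, z)))

/-- The braid relations on `n` strands, between positive words in the `n - 1` standard generators
(the letter `i : Fin (n - 1)` stands for `σ_{i+1}`). -/
inductive BraidRel (n : ℕ) : FreeMonoid (Fin (n - 1)) → FreeMonoid (Fin (n - 1)) → Prop
  | braid (i j : Fin (n - 1)) (h : i.val + 1 = j.val) :
      BraidRel n (FreeMonoid.of i * FreeMonoid.of j * FreeMonoid.of i)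
        (FreeMonoid.of j * FreeMonoid.of i * FreeMonoid.of j)
  | comm (i j : Fin (n - 1)) (h : i.val + 2 ≤ j.val) :
      BraidRel n (FreeMonoid.of i * FreeMonoid.of j) (FreeMonoid.of j * FreeMonoid.of i)

/-- The braid monoid `B_n^+`. -/
abbrev BraidMonoid (n : ℕ) : Type := PresentedMonoid (BraidRel n)

/-- The relators `u v⁻¹`, for the braid relations `u = v`. -/
def braidRelators (n : ℕ) : Set (FreeGroup (Fin (n - 1))) :=
  {r | ∃ u v, BraidRel n u v ∧
    r = FreeMonoid.lift FreeGroup.of u * (FreeMonoid.lift FreeGroup.of v)⁻¹}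

/-- The braid group `B_n`. -/
abbrev BraidGroup (n : ℕ) : Type := PresentedGroup (braidRelators n)

/-- Standard words: words in the letters `σ_i` (written `(i, true)`) and `σ_i⁻¹` (written
`(i, false)`). -/
abbrev StdWord (n : ℕ) : Type := List (Fin (n - 1) × Bool)

/-- Positive standard words: words in the letters `σ_i`. -/
abbrev PosWord (n : ℕ) : Type := List (Fin (n - 1))

/-- The element of `B_n` that a standard word represents. -/
def StdWord.toBraid {n : ℕ} (W : StdWord n) : BraidGroup n :=
  PresentedGroup.mk (braidRelators n) (FreeGroup.mk W)

/-- The element of `B_n^+` that a positive standard word represents. -/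
def PosWord.toBraid {n : ℕ} (W : PosWord n) : BraidMonoid n :=
  PresentedMonoid.mk (BraidRel n) (FreeMonoid.ofList W)

/-- The conjugacy search problem on `B_n`: given standard words `U, V`, find a standard word `X`
with `U ≡ X V X⁻¹` in `B_n`. -/
def conjugacySearch (n : ℕ) : SearchProblem where
  Inst := StdWord n × StdWord n
  Sol := StdWord n
  IsSolution := fun (U, V) X => U.toBraid = X.toBraid * V.toBraid * X.toBraid⁻¹
  InstAlphabet := (Fin (n - 1) × Bool) ⊕ (Fin (n - 1) × Bool)
  SolAlphabet := Fin (n - 1) × Bool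
  encodeInst := Computability.encodingProd (Computability.encodingList _)
    (Computability.encodingList _)
  encodeSol := Computability.encodingList _

/-- The search problem on `B_n^+`: given positive standard words `A, B, C, D`, find a positive
standard word `M` with `A M B ≡ C M D` in `B_n^+`. -/
def positiveSearch (n : ℕ) : SearchProblem where
  Inst := PosWord n × PosWord n × PosWord n × PosWord n
  Sol := PosWord n
  IsSolution := fun (A, B, C, D) M =>
    PosWord.toBraid (A ++ M ++ B) = PosWord.toBraid (C ++ M ++ D)
  InstAlphabet := Fin (n - 1) ⊕ Fin (n - 1) ⊕ Fin (n - 1) ⊕ Fin (n - 1)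
  SolAlphabet := Fin (n - 1)
  encodeInst := Computability.encodingProd (Computability.encodingList _)
    (Computability.encodingProd (Computability.encodingList _)
      (Computability.encodingProd (Computability.encodingList _) (Computability.encodingList _)))
  encodeSol := Computability.encodingList _

/-! The full twist `z = (σ_1 ⋯ σ_{n-1})^n` is central in the braid monoid and every generator
divides it on both sides (`BraidMonoid.exists_central`). Choose positive words `c i` with `σ_i · c i
= z`. Replacing each `σ_i⁻¹` in `W` by `c i` gives a positive word `P(W)`; in the group it equals
`N(W) W`, where `N(W)` has one factor `z` per negative letter. The instance is `P(U) M N(V) ≡ N(U) M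
P(V)`. After cancelling central factors it says `U M = M V` in the group, so a solution `M` is
itself a conjugator (`toGroup_equation_iff`).

Conversely, a conjugator `X` may be replaced by `P(X)`, which differs from it by a central factor.
The equation then holds in the group. Injectivity of the map from monoid to group is not needed:
localizing at `z` shows that elements equal in the group agree after multiplication by some `z ^ k`
(`BraidMonoid.exists_pow_mul_eq_of_toGroup_eq`), and `M` absorbs this factor (`exists_solution`).

Both maps concatenate a fixed number of letter-to-word substitutions of the input, which a
three-stack machine performs in linear time (`Transducer.linearTimeComputable`). -/

/-! ### Braid relations and the full twist. -/

section BraidSequence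

variable {M : Type*} [Monoid M]

/-- The elements `a 0, …, a r` satisfy the braid relations. -/
structure IsBraidSequence (a : ℕ → M) (r : ℕ) : Prop where
  braid : ∀ i, i + 1 ≤ r → a i * a (i + 1) * a i = a (i + 1) * a i * a (i + 1)
  comm : ∀ i j, i + 2 ≤ j → j ≤ r → Commute (a i) (a j)

/-- The product `a 0 * ⋯ * a (k - 1)`. -/
def initialProd (a : ℕ → M) (k : ℕ) : M := ((List.range k).map a).prod

@[simp]
theorem initialProd_zero (a : ℕ → M) : initialProd a 0 = 1 := rfl

theorem initialProd_succ (a : ℕ → M) (k : ℕ) :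
    initialProd a (k + 1) = initialProd a k * a k := by
  simp [initialProd, List.prod_range_succ]

theorem initialProd_succ' (a : ℕ → M) (k : ℕ) :
    initialProd a (k + 1) = a 0 * initialProd (fun i => a (i + 1)) k := by
  simp [initialProd, List.prod_range_succ']

namespace IsBraidSequence

variable {a : ℕ → M} {r : ℕ}

theorem commute_initialProd (h : IsBraidSequence a r) {j : ℕ} (hj : j ≤ r) :
    ∀ {k : ℕ}, k + 1 ≤ j → Commute (initialProd a k) (a j)
  | 0, _ => by simp
  | k + 1, hk => by
    rw [initialProd_succ]
    exact (h.commute_initialProd hj (by omega)).mul_left (h.comm k j (by omega) hj)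

/-- The letter `a i`, moving left, commutes with everything down to `a (i + 2)`, becomes `a (i + 1)`
by the braid relation at `a i * a (i + 1)`, and then commutes with the earlier letters. -/
theorem semiconjBy_initialProd (h : IsBraidSequence a r) {i k : ℕ} (hik : i + 2 ≤ k)
    (hk : k ≤ r + 1) : SemiconjBy (initialProd a k) (a i) (a (i + 1)) := by
  induction k, hik using Nat.le_induction with
  | base =>
    have hc : initialProd a i * a (i + 1) = a (i + 1) * initialProd a i :=
      h.commute_initialProd (by omega) le_rfl
    rw [SemiconjBy, initialProd_succ, initialProd_succ, mul_assoc, mul_assoc, ← mul_assoc (a i),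
      h.braid i (by omega), mul_assoc (a (i + 1)), ← mul_assoc, hc]
    simp only [mul_assoc]
  | succ k hik ih =>
    rw [initialProd_succ]
    exact (ih (by omega)).mul_left (h.comm i k hik (by omega)).symm

/-- The product of all the generators shifts them by one. -/
theorem semiconjBy_pow (h : IsBraidSequence a r) (i : ℕ) :
    ∀ j, i + j ≤ r → SemiconjBy (initialProd a (r + 1) ^ j) (a i) (a (i + j))
  | 0, _ => by simp
  | j + 1, hj => by
    rw [pow_succ']
    exact (h.semiconjBy_initialProd (i := i + j) (by omega) le_rfl).mul_left
      (h.semiconjBy_pow i j (by omega))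

theorem semiconjBy_initialProd_shift (h : IsBraidSequence a r) :
    ∀ k, k ≤ r → SemiconjBy (initialProd a (r + 1)) (initialProd a k)
      (initialProd (fun i => a (i + 1)) k)
  | 0, _ => by simp
  | k + 1, hk => by
    rw [initialProd_succ a k, initialProd_succ _ k]
    exact (h.semiconjBy_initialProd_shift k (by omega)).mul_right
      (h.semiconjBy_initialProd (i := k) (by omega) le_rfl)

/-- Closes the cycle: conjugation by the full product shifts indices up but does not apply to the
last generator, which the square sends back to the first. -/
theorem semiconjBy_sq (h : IsBraidSequence a r) :
    SemiconjBy (initialProd a (r + 1) ^ 2) (a r) (a 0) := by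
  have hs : initialProd a (r + 1) * initialProd a r = _ * initialProd a (r + 1) :=
    h.semiconjBy_initialProd_shift r le_rfl
  calc initialProd a (r + 1) ^ 2 * a r
      = a 0 * initialProd (fun i => a (i + 1)) r * initialProd a (r + 1) * a r := by
        rw [← initialProd_succ', sq]
    _ = a 0 * (initialProd a (r + 1) * (initialProd a r * a r)) := by
        rw [mul_assoc (a 0), ← hs]; simp only [mul_assoc]
    _ = a 0 * initialProd a (r + 1) ^ 2 := by rw [← initialProd_succ, sq]

/-- The full twist is central. -/
theorem commute_fullTwist (h : IsBraidSequence a r) {i : ℕ} (hi : i ≤ r) :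
    Commute (initialProd a (r + 1) ^ (r + 2)) (a i) := by
  have h1 := h.semiconjBy_pow i (r - i) (by omega)
  have h2 := h.semiconjBy_pow 0 i (by omega)
  rw [Nat.add_sub_cancel' hi] at h1
  rw [zero_add] at h2
  -- The index travels from `i` to `r`, then to `0`, then back to `i`, using `(r - i) + 2 + i = r +
  -- 2` factors in all.
  have := h2.mul_left (h.semiconjBy_sq.mul_left h1)
  rwa [← pow_add, ← pow_add, show i + (2 + (r - i)) = r + 2 by omega] at this

theorem exists_mul_eq_fullTwist (h : IsBraidSequence a r) {i : ℕ} (hi : i ≤ r) :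
    ∃ c, a i * c = initialProd a (r + 1) ^ (r + 2) := by
  have h2 := h.semiconjBy_pow 0 i (by omega)
  rw [zero_add] at h2
  -- Writing `δ` for the full product, `a i * δ ^ i = δ ^ i * a 0`, and the shifted product
  -- completes `a 0` to another `δ`.
  refine ⟨initialProd a (r + 1) ^ i * initialProd (fun i => a (i + 1)) r *
    initialProd a (r + 1) ^ (r + 1 - i), ?_⟩
  rw [← mul_assoc, ← mul_assoc, ← h2.eq, mul_assoc _ (a 0), ← initialProd_succ', ← pow_succ,
    ← pow_add]
  congr 1; omega

theorem exists_mul_eq_fullTwist' (h : IsBraidSequence a r) {i : ℕ} (hi : i ≤ r) :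
    ∃ c, c * a i = initialProd a (r + 1) ^ (r + 2) := by
  have h1 := h.semiconjBy_pow i (r - i) (by omega)
  rw [Nat.add_sub_cancel' hi] at h1
  refine ⟨initialProd a (r + 1) ^ (i + 1) * initialProd a r *
    initialProd a (r + 1) ^ (r - i), ?_⟩
  rw [mul_assoc, h1.eq, ← mul_assoc, mul_assoc _ _ (a r), ← initialProd_succ, ← pow_succ,
    ← pow_add]
  congr 1; omega

end IsBraidSequence

end BraidSequence

/-! ### Localization at a central element. -/

section CentralLocalization

universe u

variable {M : Type u} [Monoid M]

/-- The powers of a central element form an Ore set. -/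
@[reducible]
def oreSetPowersOfCentral (z : M) (hz : ∀ x, Commute z x) :
    OreLocalization.OreSet (Submonoid.powers z) where
  ore_right_cancel := by
    rintro r₁ r₂ ⟨_, k, rfl⟩ h
    exact ⟨⟨_, k, rfl⟩, by simpa [((hz _).pow_left k).eq] using h⟩
  oreNum r _ := r
  oreDenom _ s := s
  ore_eq := by
    rintro r ⟨_, k, rfl⟩
    exact ((hz r).pow_left k).eq

/-- If all generators divide a central element `z` on both sides, there is a homomorphism to a
monoid in which the generators become units, and which identifies only elements that agree up to
multiplication by a power of `z`. -/
theorem exists_hom_units_of_central (z : M) (hz : ∀ x, Commute z x) :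
    ∃ (N : Type u) (_ : Monoid N) (φ : M →* N),
      (∀ x, (∃ c, x * c = z) → (∃ c, c * x = z) → IsUnit (φ x)) ∧
      ∀ u v, φ u = φ v → ∃ k : ℕ, z ^ k * u = z ^ k * v := by
  let _ := oreSetPowersOfCentral z hz
  have hu : IsUnit (OreLocalization.numeratorHom (S := Submonoid.powers z) z) :=
    OreLocalization.numerator_isUnit (⟨z, 1, pow_one z⟩ : Submonoid.powers z)
  refine ⟨OreLocalization (Submonoid.powers z) M, inferInstance, OreLocalization.numeratorHom,
    ?_, ?_⟩
  · rintro x ⟨c, hc⟩ ⟨d, hd⟩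
    rw [isUnit_iff_exists_and_exists] at hu ⊢
    obtain ⟨⟨b, hb⟩, ⟨b', hb'⟩⟩ := hu
    refine ⟨⟨OreLocalization.numeratorHom c * b, ?_⟩, ⟨b' * OreLocalization.numeratorHom d, ?_⟩⟩
    · rw [← mul_assoc, ← map_mul, hc, hb]
    · rw [mul_assoc, ← map_mul, hd, hb']
  · intro u v huv
    rw [OreLocalization.numeratorHom_apply, OreLocalization.numeratorHom_apply,
      OreLocalization.oreDiv_eq_iff] at huv
    obtain ⟨⟨_, k, rfl⟩, w, h1, h2⟩ := huv
    -- Both denominators are `1`, so the two multipliers in the Ore equality coincide.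
    have hw : z ^ k = w := by simpa using h2
    subst hw
    exact ⟨k, h1.symm⟩

end CentralLocalization

/-! ### The braid monoid and its map to the braid group. -/

namespace BraidMonoid

variable (n : ℕ)

/-- The generators of the braid monoid, as a sequence (extended by `1`). -/
def generatorSeq (i : ℕ) : BraidMonoid n :=
  if h : i < n - 1 then PresentedMonoid.of (BraidRel n) ⟨i, h⟩ else 1

variable {n}

theorem generatorSeq_coe (i : Fin (n - 1)) :
    generatorSeq n i = PresentedMonoid.of (BraidRel n) i := by
  simp [generatorSeq]

theorem isBraidSequence_generatorSeq {r : ℕ} (hr : r + 1 = n - 1) :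
    IsBraidSequence (generatorSeq n) r where
  braid i hi := by
    have := PresentedMonoid.mk_eq_mk_of_rel
      (BraidRel.braid (n := n) ⟨i, by omega⟩ ⟨i + 1, by omega⟩ rfl)
    rw [generatorSeq, generatorSeq, dif_pos (by omega), dif_pos (by omega)]
    simp only [map_mul] at this
    exact this
  comm i j hij hj := by
    have := PresentedMonoid.mk_eq_mk_of_rel
      (BraidRel.comm (n := n) ⟨i, by omega⟩ ⟨j, by omega⟩ hij)
    rw [generatorSeq, generatorSeq, dif_pos (by omega), dif_pos (by omega)]
    simp only [map_mul] at this
    exact this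

/-- There is a central element of the braid monoid that every generator divides on both sides. -/
theorem exists_central (n : ℕ) : ∃ z : BraidMonoid n, (∀ x, Commute z x) ∧
    ∀ i, (∃ c, PresentedMonoid.of (BraidRel n) i * c = z) ∧
      ∃ c, c * PresentedMonoid.of (BraidRel n) i = z := by
  obtain hn | ⟨r, hr⟩ : n - 1 = 0 ∨ ∃ r, r + 1 = n - 1 := by
    rcases hm : n - 1 with _ | r
    · exact .inl rfl
    · exact .inr ⟨r, rfl⟩
  -- For `n ≤ 1` there are no generators, so divisibility is vacuous.
  · exact ⟨1, fun x => Commute.one_left x, fun i => absurd i.isLt (by omega)⟩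
  · have h := isBraidSequence_generatorSeq hr
    refine ⟨initialProd (generatorSeq n) (r + 1) ^ (r + 2), fun x => ?_, fun i => ?_⟩
    rotate_left
    · rw [← generatorSeq_coe]
      exact ⟨h.exists_mul_eq_fullTwist (by omega), h.exists_mul_eq_fullTwist' (by omega)⟩
    · have hx : x ∈ Submonoid.closure (Set.range (PresentedMonoid.of (BraidRel n))) := by simp
      induction hx using Submonoid.closure_induction with
      | mem x hx =>
        obtain ⟨i, rfl⟩ := hx
        rw [← generatorSeq_coe]
        exact h.commute_fullTwist (by omega)
      | one => exact Commute.one_right _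
      | mul x y _ _ hx hy => exact hx.mul_right hy

theorem lift_eq_of_braidRel {u v : FreeMonoid (Fin (n - 1))} (h : BraidRel n u v) :
    FreeMonoid.lift (PresentedGroup.of (rels := braidRelators n)) u =
      FreeMonoid.lift (PresentedGroup.of (rels := braidRelators n)) v := by
  have hw : ∀ w : FreeMonoid (Fin (n - 1)),
      FreeMonoid.lift (PresentedGroup.of (rels := braidRelators n)) w =
        PresentedGroup.mk (braidRelators n) (FreeMonoid.lift FreeGroup.of w) := fun w =>
    DFunLike.congr_fun (f := FreeMonoid.lift _)
      (g := (PresentedGroup.mk _).comp (FreeMonoid.lift FreeGroup.of))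
      (FreeMonoid.hom_eq fun i => rfl) w
  rw [hw, hw, ← mul_inv_eq_one, ← map_inv, ← map_mul]
  exact (QuotientGroup.eq_one_iff _).2 (Subgroup.subset_normalClosure ⟨u, v, h, rfl⟩)

/-- The canonical homomorphism from the braid monoid to the braid group. -/
def toGroup (n : ℕ) : BraidMonoid n →* BraidGroup n :=
  PresentedMonoid.lift PresentedGroup.of fun _ _ => lift_eq_of_braidRel

theorem toGroup_of (i : Fin (n - 1)) :
    toGroup n (PresentedMonoid.of (BraidRel n) i) = PresentedGroup.of i := rfl

/-- Elements of the braid monoid that are equal in the braid group are equal up to multiplication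
by a power of `z`. -/
theorem exists_pow_mul_eq_of_toGroup_eq {z : BraidMonoid n} (hz : ∀ x, Commute z x)
    (hd : ∀ i, (∃ c, PresentedMonoid.of (BraidRel n) i * c = z) ∧
      ∃ c, c * PresentedMonoid.of (BraidRel n) i = z)
    {u v : BraidMonoid n} (huv : toGroup n u = toGroup n v) :
    ∃ k : ℕ, z ^ k * u = z ^ k * v := by
  obtain ⟨N, _, φ, hφ, hk⟩ := exists_hom_units_of_central z hz
  apply hk
  -- The generators become units in `N`, so `φ` factors through the braid group and `φ u = φ v`
  -- follows from equality there.
  let s : Fin (n - 1) → Nˣ := fun i => (hφ _ (hd i).1 (hd i).2).unit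
  have hs : ∀ w : FreeMonoid (Fin (n - 1)),
      ((FreeGroup.lift s (FreeMonoid.lift FreeGroup.of w) : Nˣ) : N) =
        φ (PresentedMonoid.mk _ w) := fun w =>
    DFunLike.congr_fun
      (f := (Units.coeHom N).comp ((FreeGroup.lift s).comp (FreeMonoid.lift FreeGroup.of)))
      (g := φ.comp (PresentedMonoid.mk _)) (FreeMonoid.hom_eq fun i => by simp [s]; rfl) w
  have hrel : ∀ r ∈ braidRelators n, FreeGroup.lift s r = 1 := by
    rintro _ ⟨u, v, h, rfl⟩
    rw [map_mul, map_inv, mul_inv_eq_one]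
    ext
    rw [hs, hs, PresentedMonoid.mk_eq_mk_of_rel h]
  have hψ : ∀ w, ((PresentedGroup.toGroup hrel (toGroup n w) : Nˣ) : N) = φ w := fun w =>
    DFunLike.congr_fun
      (f := (Units.coeHom N).comp ((PresentedGroup.toGroup hrel).comp (toGroup n)))
      (g := φ) (PresentedMonoid.ext _ fun i => by
        simp [toGroup_of, PresentedGroup.toGroup.of, s]) w
  rw [← hψ, ← hψ, huv]

end BraidMonoid

/-! ### Words and the clearing of negative letters. -/

section Words

variable {n : ℕ}

theorem PosWord.toBraid_append (A B : PosWord n) :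
    PosWord.toBraid (A ++ B) = A.toBraid * B.toBraid := by
  simp [PosWord.toBraid]

theorem PosWord.toBraid_nil : PosWord.toBraid ([] : PosWord n) = 1 := rfl

theorem PosWord.toBraid_cons (i : Fin (n - 1)) (W : PosWord n) :
    PosWord.toBraid (i :: W) = PresentedMonoid.of (BraidRel n) i * W.toBraid :=
  PosWord.toBraid_append [i] W

theorem PosWord.toBraid_surjective (x : BraidMonoid n) : ∃ W : PosWord n, W.toBraid = x := by
  obtain ⟨w, rfl⟩ := PresentedMonoid.surjective_mk x
  exact ⟨w.toList, rfl⟩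

theorem StdWord.toBraid_nil : StdWord.toBraid ([] : StdWord n) = 1 := rfl

theorem StdWord.toBraid_append (A B : StdWord n) :
    StdWord.toBraid (A ++ B) = A.toBraid * B.toBraid := by
  simp [StdWord.toBraid, ← FreeGroup.mul_mk]

theorem StdWord.toBraid_cons (x : Fin (n - 1) × Bool) (W : StdWord n) :
    StdWord.toBraid (x :: W) = StdWord.toBraid [x] * W.toBraid :=
  StdWord.toBraid_append [x] W

theorem StdWord.toBraid_true (i : Fin (n - 1)) :
    StdWord.toBraid [(i, true)] = PresentedGroup.of i := rfl

theorem StdWord.toBraid_false (i : Fin (n - 1)) :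
    StdWord.toBraid [(i, false)] = (PresentedGroup.of i : BraidGroup n)⁻¹ := rfl

/-- A positive word, as a standard word. -/
def PosWord.toStd (W : PosWord n) : StdWord n := W.flatMap fun i => [(i, true)]

theorem PosWord.toBraid_toStd (W : PosWord n) :
    W.toStd.toBraid = BraidMonoid.toGroup n W.toBraid := by
  induction W with
  | nil => simp [toStd, toBraid_nil, StdWord.toBraid_nil]
  | cons i W ih =>
    change StdWord.toBraid ((i, true) :: PosWord.toStd W) = _
    rw [StdWord.toBraid_cons, ih, PosWord.toBraid_cons, map_mul]
    rfl

/-- Replace negative letters `σ_i⁻¹` by the positive words `c i`. -/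
def StdWord.positivePart (c : Fin (n - 1) → PosWord n) (W : StdWord n) : PosWord n :=
  W.flatMap fun x => if x.2 then [x.1] else c x.1

/-- One copy of the positive word `Z` for each negative letter. -/
def StdWord.negativePower (Z : PosWord n) (W : StdWord n) : PosWord n :=
  W.flatMap fun x => if x.2 then [] else Z

theorem commute_toBraid {ζ : BraidGroup n} (hζ : ∀ i, Commute ζ (PresentedGroup.of i))
    (W : StdWord n) : Commute ζ W.toBraid := by
  induction W with
  | nil => exact Commute.one_right _
  | cons x W ih =>
    rw [StdWord.toBraid_cons]
    obtain ⟨i, _ | _⟩ := x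
    · exact (hζ i).inv_right.mul_right ih
    · exact (hζ i).mul_right ih

theorem StdWord.positivePart_cons_true (c : Fin (n - 1) → PosWord n) (i : Fin (n - 1))
    (W : StdWord n) : positivePart c ((i, true) :: W) = i :: positivePart c W := rfl

theorem StdWord.positivePart_cons_false (c : Fin (n - 1) → PosWord n) (i : Fin (n - 1))
    (W : StdWord n) : positivePart c ((i, false) :: W) = c i ++ positivePart c W := rfl

theorem StdWord.negativePower_cons_true (Z : PosWord n) (i : Fin (n - 1)) (W : StdWord n) :
    negativePower Z ((i, true) :: W) = negativePower Z W := rfl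

theorem StdWord.negativePower_cons_false (Z : PosWord n) (i : Fin (n - 1)) (W : StdWord n) :
    negativePower Z ((i, false) :: W) = Z ++ negativePower Z W := rfl

theorem commute_negativePower {Z : PosWord n} (hZ : ∀ x, Commute Z.toBraid x) (W : StdWord n)
    (x : BraidMonoid n) : Commute (W.negativePower Z).toBraid x := by
  induction W with
  | nil => exact Commute.one_left _
  | cons y W ih =>
    obtain ⟨i, _ | _⟩ := y
    · rw [StdWord.negativePower_cons_false, PosWord.toBraid_append]
      exact (hZ x).mul_left ih
    · exact ih

theorem commute_toGroup_negativePower {Z : PosWord n} (hZ : ∀ x, Commute Z.toBraid x)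
    (W W' : StdWord n) :
    Commute (BraidMonoid.toGroup n (W.negativePower Z).toBraid) W'.toBraid :=
  commute_toBraid (fun i => (commute_negativePower hZ W (PresentedMonoid.of _ i)).map _) W'

/-- In the group `c i` equals `σ_i⁻¹` times a central element, and the central factors can be
collected in front. -/
theorem toGroup_positivePart {c : Fin (n - 1) → PosWord n} {Z : PosWord n}
    (hZ : ∀ x, Commute Z.toBraid x)
    (hc : ∀ i, PresentedMonoid.of (BraidRel n) i * (c i).toBraid = Z.toBraid) (W : StdWord n) :
    BraidMonoid.toGroup n (W.positivePart c).toBraid =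
      BraidMonoid.toGroup n (W.negativePower Z).toBraid * W.toBraid := by
  induction W with
  | nil => exact (mul_one _).symm
  | cons x W ih =>
    obtain ⟨i, _ | _⟩ := x
    · have hP := (commute_toGroup_negativePower hZ ((i, false) :: W) [(i, true)]).eq
      rw [StdWord.toBraid_true, StdWord.negativePower_cons_false, PosWord.toBraid_append,
        map_mul] at hP
      rw [StdWord.positivePart_cons_false, StdWord.negativePower_cons_false,
        PosWord.toBraid_append, PosWord.toBraid_append, StdWord.toBraid_cons, map_mul, map_mul,
        ih, StdWord.toBraid_false, ← mul_right_inj (PresentedGroup.of i : BraidGroup n),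
        ← mul_assoc, ← BraidMonoid.toGroup_of, ← map_mul, hc,
        ← mul_assoc (BraidMonoid.toGroup n _) (_ * _), BraidMonoid.toGroup_of, ← hP, mul_assoc, mul_assoc, mul_inv_cancel_left]
    · rw [StdWord.positivePart_cons_true, StdWord.negativePower_cons_true, PosWord.toBraid_cons,
        StdWord.toBraid_cons, map_mul, ih, ← mul_assoc, ← mul_assoc,
        (commute_toGroup_negativePower hZ W [(i, true)]).eq]
      rfl

end Words

/-! ### Equivalence of the conjugacy equation and the positive equation. -/

section Equations

variable {n : ℕ} {c : Fin (n - 1) → PosWord n} {Z : PosWord n}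

/-- The equation in the braid monoid that a conjugacy problem is turned into is, in the braid
group, equivalent to the original one. -/
theorem toGroup_equation_iff (hZ : ∀ x, Commute Z.toBraid x)
    (hc : ∀ i, PresentedMonoid.of (BraidRel n) i * (c i).toBraid = Z.toBraid)
    (U V : StdWord n) (M : PosWord n) :
    BraidMonoid.toGroup n (U.positivePart c ++ M ++ V.negativePower Z).toBraid =
      BraidMonoid.toGroup n (U.negativePower Z ++ M ++ V.positivePart c).toBraid ↔
    U.toBraid = M.toStd.toBraid * V.toBraid * M.toStd.toBraid⁻¹ := by
  have h1 := (commute_toGroup_negativePower hZ V M.toStd).eq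
  have h2 := (commute_toGroup_negativePower hZ V U).eq
  have h3 := (commute_toGroup_negativePower hZ V (U.negativePower Z).toStd).eq
  rw [PosWord.toBraid_toStd] at h3
  rw [eq_mul_inv_iff_mul_eq]
  simp only [PosWord.toBraid_append, map_mul, toGroup_positivePart hZ hc,
    ← PosWord.toBraid_toStd M]
  -- Moving the central factor of `V` leftwards gives both sides the common prefix `N(U) N(V)`,
  -- followed by `U M` and `M V` respectively.
  rw [mul_assoc _ _ (BraidMonoid.toGroup n (V.negativePower Z).toBraid), ← h1,
    mul_assoc _ U.toBraid, ← mul_assoc U.toBraid, ← h2, mul_assoc _ M.toStd.toBraid,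
    ← mul_assoc M.toStd.toBraid, ← h1]
  simp only [mul_assoc, mul_right_inj]

theorem exists_solution (hZ : ∀ x, Commute Z.toBraid x)
    (hc : ∀ i, PresentedMonoid.of (BraidRel n) i * (c i).toBraid = Z.toBraid)
    (hd : ∀ i, ∃ d, d * PresentedMonoid.of (BraidRel n) i = Z.toBraid)
    {U V X : StdWord n} (h : U.toBraid = X.toBraid * V.toBraid * X.toBraid⁻¹) :
    ∃ M : PosWord n, PosWord.toBraid (U.positivePart c ++ M ++ V.negativePower Z) =
      PosWord.toBraid (U.negativePower Z ++ M ++ V.positivePart c) := by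
  -- The positive part of `X` is `X` times a central element, hence conjugates in the same way.
  have hX : U.toBraid = (X.positivePart c).toStd.toBraid * V.toBraid *
      (X.positivePart c).toStd.toBraid⁻¹ := by
    rw [PosWord.toBraid_toStd, toGroup_positivePart hZ hc, mul_inv_rev, mul_assoc _ X.toBraid,
      mul_assoc _ (X.toBraid * V.toBraid), ← mul_assoc (X.toBraid * V.toBraid), ← h, ← mul_assoc,
      (commute_toGroup_negativePower hZ X U).eq, mul_inv_cancel_right]
  rw [← toGroup_equation_iff hZ hc] at hX
  obtain ⟨k, hk⟩ := BraidMonoid.exists_pow_mul_eq_of_toGroup_eq hZ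
    (fun i => ⟨⟨_, hc i⟩, hd i⟩) hX
  -- The factor `z ^ k` needed to lift the equation to the monoid is central, so it can be placed
  -- inside the unknown.
  obtain ⟨Y, hY⟩ := PosWord.toBraid_surjective (Z.toBraid ^ k)
  refine ⟨Y ++ X.positivePart c, ?_⟩
  simp only [PosWord.toBraid_append, hY] at hk ⊢
  simp only [← mul_assoc] at hk ⊢
  rwa [← ((hZ _).pow_left k).eq, ← ((hZ (StdWord.negativePower Z U).toBraid).pow_left k).eq]

end Equations

/-! ### Linear-time letter-to-word substitutions on a stack machine. -/

namespace Transducer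

open Turing Turing.TM2.Stmt StateTransition

/-- The contents: the input, a work stack, and the output. -/
inductive Stack
  | input
  | work
  | output
  deriving DecidableEq

instance : Fintype Stack where
  elems := {.input, .work, .output}
  complete k := by cases k <;> simp

/-- The alphabets of the contents. -/
@[reducible]
def Alphabet (I O : Type) : Stack → Type
  | .input => I
  | .work => I
  | .output => O

/-- The labels of a transducer with `m` channels. Label `load k` moves the input to the work stack,
with the channels `j < k` still to be run; `emit j` moves it back and runs channel `j`. -/
inductive Label (I : Type) (m : ℕ)
  | load (k : Fin (m + 1))
  | store (k : Fin (m + 1)) (i : I)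
  | emit (j : Fin m)
  | write (j : Fin m) (i : I)
  deriving Fintype

variable {I O : Type} {m : ℕ}

/-- Push a word onto the output stack, so that it can be read off from the top. -/
def pushOutput (w : List O) (q : TM2.Stmt (Alphabet I O) (Label I m) (Option I)) :
    TM2.Stmt (Alphabet I O) (Label I m) (Option I) :=
  w.foldl (fun q b => push Stack.output (fun _ => b) q) q

/-- The program of a transducer. -/
def program (h : Fin m → I → List O) :
    Label I m → TM2.Stmt (Alphabet I O) (Label I m) (Option I)
  | .load k => pop Stack.input (fun _ o => o)
      (branch Option.isSome
        (goto fun v => match v with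
          | some i => .store k i
          | none => .load k)
        (Fin.cases halt (fun j => goto fun _ => .emit j) k))
  -- When no channel is left (`k = 0`) the letter is discarded: a halting configuration must have
  -- every stack but the output empty.
  | .store k i =>
      Fin.cases (goto fun _ => .load 0) (fun j => push Stack.work (fun _ => i)
        (goto fun _ => .load j.succ)) k
  | .emit j => pop Stack.work (fun _ o => o)
      (goto fun v => match v with
        | some i => .write j i
        | none => .load j.castSucc)
  | .write j i => push Stack.input (fun _ => i) (pushOutput (h j i) (goto fun _ => .emit j))

/-- The transducer with channels `h`. -/
@[reducible]
def machine [Fintype I] (h : Fin m → I → List O) : FinTM2 where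
  K := Stack
  k₀ := .input
  k₁ := .output
  Γ := Alphabet I O
  Λ := Label I m
  -- Channels run from last to first, because what is pushed last ends up on top of the output.
  main := .load (Fin.last m)
  σ := Option I
  initialState := none
  Γk₀Fin := inferInstanceAs (Fintype I)
  m := program h

/-- The contents of the contents. -/
def contents (x y : List I) (o : List O) : ∀ k, List (Alphabet I O k)
  | .input => x
  | .work => y
  | .output => o

/-- A configuration of a transducer. -/
@[reducible]
def cfg (l : Option (Label I m)) (v : Option I) (x y : List I) (o : List O) :
    TM2.Cfg (Alphabet I O) (Label I m) (Option I) :=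
  ⟨l, v, contents x y o⟩

@[simp]
theorem update_input (x x' y : List I) (o : List O) :
    Function.update (contents x y o) Stack.input x' = contents x' y o := by
  funext k; cases k <;> rfl

@[simp]
theorem update_work (x y y' : List I) (o : List O) :
    Function.update (contents x y o) Stack.work y' = contents x y' o := by
  funext k; cases k <;> rfl

@[simp]
theorem update_output (x y : List I) (o o' : List O) :
    Function.update (contents x y o) Stack.output o' = contents x y o' := by
  funext k; cases k <;> rfl

theorem stepAux_pushOutput (w : List O) (q : TM2.Stmt (Alphabet I O) (Label I m) (Option I))
    (v : Option I) (x y : List I) (o : List O) :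
    TM2.stepAux (pushOutput w q) v (contents x y o) = TM2.stepAux q v (contents x y (w ++ o)) := by
  induction w generalizing q with
  | nil => rfl
  | cons b w ih =>
    refine (ih _).trans ?_
    rw [TM2.stepAux, update_output]
    rfl

variable (h : Fin m → I → List O)

/-- `b` is reached from `a` in exactly `t` steps. -/
def Runs (t : ℕ) (a b : TM2.Cfg (Alphabet I O) (Label I m) (Option I)) : Prop :=
  (flip bind (TM2.step (program h)))^[t] (some a) = some b

variable {h}

theorem Runs.trans {s t : ℕ} {a b c : TM2.Cfg (Alphabet I O) (Label I m) (Option I)}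
    (hab : Runs h s a b) (hbc : Runs h t b c) : Runs h (t + s) a c := by
  rw [Runs, Function.iterate_add_apply, hab, hbc]

theorem Runs.of_step {a b : TM2.Cfg (Alphabet I O) (Label I m) (Option I)}
    (hab : TM2.step (program h) a = some b) : Runs h 1 a b := hab

theorem step_store_zero (i : I) (v : Option I) (x y : List I) (o : List O) :
    Runs h 1 (cfg (some (.store 0 i)) v x y o) (cfg (some (.load 0)) v x y o) := rfl

theorem step_store_succ (j : Fin m) (i : I) (v : Option I) (x y : List I) (o : List O) :
    Runs h 1 (cfg (some (.store j.succ i)) v x y o)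
      (cfg (some (.load j.succ)) v x (i :: y) o) := by
  apply Runs.of_step
  simp [program, contents]

theorem step_load_cons (k : Fin (m + 1)) (i : I) (v : Option I) (x y : List I) (o : List O) :
    Runs h 1 (cfg (some (.load k)) v (i :: x) y o) (cfg (some (.store k i)) (some i) x y o) := by
  apply Runs.of_step
  simp [program, contents]

theorem step_load_zero_nil (v : Option I) (y : List I) (o : List O) :
    Runs h 1 (cfg (some (.load 0)) v [] y o) (cfg none none [] y o) := by
  apply Runs.of_step
  simp [program, contents]

theorem step_load_succ_nil (j : Fin m) (v : Option I) (y : List I) (o : List O) :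
    Runs h 1 (cfg (some (.load j.succ)) v [] y o) (cfg (some (.emit j)) none [] y o) := by
  apply Runs.of_step
  simp [program, contents]

theorem step_emit_nil (j : Fin m) (v : Option I) (x : List I) (o : List O) :
    Runs h 1 (cfg (some (.emit j)) v x [] o) (cfg (some (.load j.castSucc)) none x [] o) := by
  apply Runs.of_step
  simp [program, contents]

theorem step_emit_cons (j : Fin m) (i : I) (v : Option I) (x y : List I) (o : List O) :
    Runs h 1 (cfg (some (.emit j)) v x (i :: y) o) (cfg (some (.write j i)) (some i) x y o) := by
  apply Runs.of_step
  simp [program, contents]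

theorem step_write (j : Fin m) (i : I) (v : Option I) (x y : List I) (o : List O) :
    Runs h 1 (cfg (some (.write j i)) v x y o)
      (cfg (some (.emit j)) v (i :: x) y (h j i ++ o)) := by
  apply Runs.of_step
  simp [program, contents, stepAux_pushOutput]

theorem runs_load_zero (x : List I) (v : Option I) (y : List I) (o : List O) :
    Runs h (2 * x.length + 1) (cfg (some (.load 0)) v x y o) (cfg none none [] y o) := by
  induction x generalizing v with
  | nil => exact step_load_zero_nil v y o
  | cons i x ih =>
    exact ((step_load_cons 0 i v x y o).trans (step_store_zero i _ x y o)).trans (ih _)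

theorem runs_load_succ (j : Fin m) (x : List I) (v : Option I) (y : List I) (o : List O) :
    Runs h (2 * x.length + 1) (cfg (some (.load j.succ)) v x y o)
      (cfg (some (.emit j)) none [] (x.reverse ++ y) o) := by
  induction x generalizing v y with
  | nil => exact step_load_succ_nil j v y o
  | cons i x ih =>
    rw [List.reverse_cons, List.append_assoc]
    exact ((step_load_cons j.succ i v x y o).trans (step_store_succ j i _ x y o)).trans (ih _ _)

/-- The work stack is popped in the reverse of the input order, so stacking up the output words puts
them in input order, and the input is rebuilt for the next channel. -/
theorem runs_emit (j : Fin m) (y : List I) (v : Option I) (x : List I) (o : List O) :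
    Runs h (2 * y.length + 1) (cfg (some (.emit j)) v x y o)
      (cfg (some (.load j.castSucc)) none (y.reverse ++ x) [] (y.reverse.flatMap (h j) ++ o)) := by
  induction y generalizing v x o with
  | nil => exact step_emit_nil j v x o
  | cons i y ih =>
    simp only [List.reverse_cons, List.flatMap_append, List.append_assoc, List.flatMap_cons,
      List.flatMap_nil, List.append_nil, List.cons_append, List.nil_append]
    exact ((step_emit_cons j i v x y o).trans (step_write j i _ x y o)).trans (ih _ _ _)

theorem runs_channel (j : Fin m) (x : List I) (v : Option I) (o : List O) :
    Runs h (4 * x.length + 2) (cfg (some (.load j.succ)) v x [] o)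
      (cfg (some (.load j.castSucc)) none x [] (x.flatMap (h j) ++ o)) := by
  have := (runs_load_succ (h := h) j x v [] o).trans (runs_emit j _ none [] o)
  simp only [List.append_nil, List.reverse_reverse, List.length_reverse] at this
  convert this using 1
  ring

theorem runs_load (x : List I) (k : ℕ) (hk : k < m + 1) (v : Option I) (o : List O) :
    Runs h (k * (4 * x.length + 2) + (2 * x.length + 1)) (cfg (some (.load ⟨k, hk⟩)) v x [] o)
      (cfg none none [] []
        ((List.ofFn fun j : Fin k => x.flatMap (h (j.castLE (by omega)))).flatten ++ o)) := by
  induction k generalizing v o with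
  | zero => simpa using runs_load_zero (h := h) x v [] o
  | succ k ih =>
    have h1 := (runs_channel (h := h) ⟨k, by omega⟩ x v o).trans
      (ih (by omega) none (x.flatMap (h ⟨k, by omega⟩) ++ o))
    -- The last channel is split off: it runs first, so its output lies below that of the others.
    rw [List.ofFn_succ', List.concat_eq_append, List.flatten_append, List.append_assoc]
    convert h1 using 1
    · ring
    · rfl
    · rw [List.flatten_cons, List.flatten_nil, List.append_nil]
      rfl

/-- Running a fixed number of letter-to-word substitutions one after the other on the input is
possible in linear time. -/
theorem linearTimeComputable [Fintype I] {α β : Type} {ea : α → List I} {eb : β → List O}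
    {f : α → β} (h : Fin m → I → List O)
    (hf : ∀ x, eb (f x) = (List.ofFn fun j => (ea x).flatMap (h j)).flatten) :
    LinearTimeComputable ea eb f := by
  refine ⟨⟨⟨machine h, Equiv.refl _, Equiv.refl _⟩, fun k => m * (4 * k + 2) + (2 * k + 1),
    fun x => ⟨⟨m * (4 * (ea x).length + 2) + (2 * (ea x).length + 1), ?_⟩, le_rfl⟩⟩,
    4 * m + 2, fun k => by dsimp only; nlinarith⟩
  have hr := runs_load (h := h) (ea x) m (by omega) none []
  have hi : initList (machine h) (ea x) = cfg (some (.load (Fin.last m))) none (ea x) [] [] := by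
    simp only [initList, cfg]
    congr 1
    funext k; cases k <;> rfl
  have ho : haltList (machine h) (eb (f x)) = cfg none none [] [] (eb (f x)) := by
    simp only [haltList, cfg]
    congr 1
    funext k; cases k <;> rfl
  rw [List.append_nil] at hr
  have hr' : (flip bind (machine h).step)^[m * (4 * (ea x).length + 2) + (2 * (ea x).length + 1)]
      (some (initList (machine h) (ea x))) = some (haltList (machine h) (eb (f x))) := by
    rw [hi, ho, hf]
    exact hr
  have hid : ∀ (T : Type) (l : List T), l.map (Equiv.refl T).invFun = l := fun T l => List.map_id l
  dsimp only
  erw [hid, hid]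
  exact hr'

end Transducer

/-! ### The two maps of the reduction and the conclusion. -/

theorem linearTimeComputable_positiveInstance {n : ℕ} (c : Fin (n - 1) → PosWord n)
    (Z : PosWord n) :
    LinearTimeComputable (conjugacySearch n).encodeInst.encode (positiveSearch n).encodeInst.encode
      fun p : StdWord n × StdWord n => (p.1.positivePart c, p.2.negativePower Z,
        p.1.negativePower Z, p.2.positivePart c) := by
  have : Fintype (conjugacySearch n).InstAlphabet := (conjugacySearch n).instFintype
  let pos (x : Fin (n - 1) × Bool) : PosWord n := if x.2 then [x.1] else c x.1
  let neg (x : Fin (n - 1) × Bool) : PosWord n := if x.2 then [] else Z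
  refine Transducer.linearTimeComputable (m := 4)
    -- One channel per component of the instance; each erases the letters of one input word and tags
    -- its output with its component.
    ![Sum.elim (fun x => (pos x).map Sum.inl) fun _ => [],
      Sum.elim (fun _ => []) fun x => (neg x).map (Sum.inr ∘ Sum.inl),
      Sum.elim (fun x => (neg x).map (Sum.inr ∘ Sum.inr ∘ Sum.inl)) fun _ => [],
      Sum.elim (fun _ => []) fun x => (pos x).map (Sum.inr ∘ Sum.inr ∘ Sum.inr)] ?_
  have hnil {α β : Type} (l : List α) : l.flatMap (fun _ => ([] : List β)) = [] := by simp
  rintro ⟨U, V⟩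
  simp [hnil, conjugacySearch, positiveSearch, Computability.encodingProd, Computability.encodingList,
    StdWord.positivePart, StdWord.negativePower, List.flatMap_map, List.map_flatMap, pos, neg,
    Function.comp_def]

theorem linearTimeComputable_toStd (n : ℕ) :
    LinearTimeComputable
      (Computability.encodingProd (conjugacySearch n).encodeInst (positiveSearch n).encodeSol).encode
      (conjugacySearch n).encodeSol.encode
      fun p : (StdWord n × StdWord n) × PosWord n => p.2.toStd := by
  have : Fintype ((conjugacySearch n).InstAlphabet ⊕ (positiveSearch n).SolAlphabet) :=
    @instFintypeSum _ _ (conjugacySearch n).instFintype (positiveSearch n).solFintype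
  refine Transducer.linearTimeComputable (m := 1)
    (fun _ => Sum.elim (fun _ => []) fun i => [(i, true)]) ?_
  have key (W : List ((Fin (n - 1) × Bool) ⊕ (Fin (n - 1) × Bool))) (M : PosWord n) :
      M.toStd = (List.ofFn fun _ : Fin 1 => (W.map Sum.inl ++ M.map Sum.inr).flatMap
        (Sum.elim (fun _ => []) fun i => [(i, true)])).flatten := by
    simp [PosWord.toStd, List.flatMap_map]
  rintro ⟨⟨U, V⟩, M⟩
  exact key _ M

theorem theorem7 (n : ℕ) :
    (conjugacySearch n).LinearTimeReducible (positiveSearch n) := by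
  obtain ⟨z, hz, hdvd⟩ := BraidMonoid.exists_central n
  obtain ⟨Z, rfl⟩ := PosWord.toBraid_surjective z
  -- `Z` and the complements of the generators are fixed once `n` is, so they can be built into the
  -- machine.
  have hc : ∀ i, ∃ C : PosWord n, PresentedMonoid.of (BraidRel n) i * C.toBraid = Z.toBraid := by
    intro i
    obtain ⟨x, hx⟩ := (hdvd i).1
    obtain ⟨C, rfl⟩ := PosWord.toBraid_surjective x
    exact ⟨C, hx⟩
  choose c hc using hc
  -- The two computability statements determine the maps; the second returns `M` itself as the
  -- conjugator.
  refine ⟨_, _, linearTimeComputable_positiveInstance c Z, linearTimeComputable_toStd n, ?_, ?_⟩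
  · rintro ⟨U, V⟩ ⟨X, hX⟩
    exact exists_solution hz hc (fun i => (hdvd i).2) hX
  · rintro ⟨U, V⟩ M hM
    exact (toGroup_equation_iff hz hc U V M).1 (congrArg (BraidMonoid.toGroup n) hM)
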